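/- Let $N\in\mathbb N$, let $\Omega\subset\mathbb R^N$ be a nonempty bounded open set, let $p>1$ and $p'=\frac{p}{p-1}$, and let $1\le m<\max\{1,\frac{N}{3p'}\}$. Then there is a function $f\in L^m(\Omega)$ with $f\ge 0$ a.e. in $\Omega$ and $f\not\equiv 0$ (that is, $f$ is not a.e. equal to $0$ in $\Omega$), such that for every $\lambda>0$ the problem $$\Delta^2u=|\nabla u|^p+\lambda f\ \text{ in }\Omega,\qquad u=\Delta u=0\ \text{ on }\partial\Omega,\qquad u\ge 0\ \text{ in }\Omega,$$ has no weak solution. Here a weak solution is a function $u\in W^{1,p}_0(\Omega)$ with $u\ge 0$ a.e. in $\Omega$, for which there is $v\in W^{1,1}_0(\Omega)$ (so $v=-\Delta u$) such that for all $\varphi,\psi\in C_0^\infty(\Omega)$ $$\int_\Omega\nabla\varphi\cdot\nabla u\,dx=\int_\Omega v\,\varphi\,dx\qquad\text{and}\qquad \int_\Omega\nabla\psi\cdot\nabla v\,dx=\int_\Omega|\nabla u|^p\,\psi\,dx+\lambda\int_\Omega f\,\psi\,dx .$$ -/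

import Mathlib

open MeasureTheory Filter Topology
open scoped ENNReal ContDiff

/-- `φ ∈ C₀^∞(Ω)`: smooth with compact support contained in `Ω`. -/
structure IsTestFunction {N : ℕ} (Ω : Set (EuclideanSpace ℝ (Fin N)))
    (φ : EuclideanSpace ℝ (Fin N) → ℝ) : Prop where
  smooth : ContDiff ℝ ∞ φ
  compact_support : HasCompactSupport φ
  support_subset : tsupport φ ⊆ Ω

/-- `G` is the weak gradient of `u` on `Ω`:
`∫_Ω u ∇φ = - ∫_Ω φ G` for all test functions `φ` (an identity of vectors). -/
structure HasWeakGradient {N : ℕ} (Ω : Set (EuclideanSpace ℝ (Fin N)))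
    (u : EuclideanSpace ℝ (Fin N) → ℝ)
    (G : EuclideanSpace ℝ (Fin N) → EuclideanSpace ℝ (Fin N)) : Prop where
  locallyIntegrable : LocallyIntegrableOn u Ω volume
  locallyIntegrable_grad : LocallyIntegrableOn G Ω volume
  integral_eq : ∀ φ : EuclideanSpace ℝ (Fin N) → ℝ, IsTestFunction Ω φ →
    ∫ x in Ω, u x • gradient φ x = - ∫ x in Ω, φ x • G x

/-- `u ∈ W₀^{1,r}(Ω)` with weak gradient `G`: `u` and `G` are in `L^r(Ω)`, and `u` is a limit
of test functions in the norm of `W^{1,r}(Ω)`. -/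
structure MemSobolevZero {N : ℕ} (Ω : Set (EuclideanSpace ℝ (Fin N))) (r : ℝ≥0∞)
    (u : EuclideanSpace ℝ (Fin N) → ℝ)
    (G : EuclideanSpace ℝ (Fin N) → EuclideanSpace ℝ (Fin N)) : Prop where
  memLp : MemLp u r (volume.restrict Ω)
  memLp_grad : MemLp G r (volume.restrict Ω)
  weakGradient : HasWeakGradient Ω u G
  approx : ∃ φ : ℕ → EuclideanSpace ℝ (Fin N) → ℝ, (∀ n, IsTestFunction Ω (φ n)) ∧
    Tendsto (fun n => eLpNorm (fun x => φ n x - u x) r (volume.restrict Ω)) atTop (𝓝 0) ∧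
    Tendsto (fun n => eLpNorm (fun x => gradient (φ n) x - G x) r (volume.restrict Ω))
      atTop (𝓝 0)

/-- The weak form of `-Δw = h` in `Ω` for a function `w` with weak gradient `G`:
`∫_Ω ∇φ · G = ∫_Ω h φ` for all test functions `φ`. -/
def SolvesWeakPoisson {N : ℕ} (Ω : Set (EuclideanSpace ℝ (Fin N)))
    (G : EuclideanSpace ℝ (Fin N) → EuclideanSpace ℝ (Fin N))
    (h : EuclideanSpace ℝ (Fin N) → ℝ) : Prop :=
  ∀ φ : EuclideanSpace ℝ (Fin N) → ℝ, IsTestFunction Ω φ →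
    ∫ x in Ω, inner ℝ (gradient φ x) (G x) = ∫ x in Ω, h x * φ x

/-- `u` is a (nonnegative) weak solution of
`Δ²u = |∇u|^p + l f` in `Ω`, `u = Δu = 0` on `∂Ω`, `u ≥ 0` in `Ω`.
Here `u ∈ W₀^{1,p}(Ω)`, and `v = -Δu` belongs to `W₀^{1,1}(Ω)` and satisfies
`-Δv = |∇u|^p + l f`, both equations being understood in the sense of distributions. The sign of
`v` is not prescribed. -/
def IsPositiveWeakSolution {N : ℕ} (Ω : Set (EuclideanSpace ℝ (Fin N))) (p l : ℝ)
    (f u : EuclideanSpace ℝ (Fin N) → ℝ) : Prop :=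
  (∀ᵐ x ∂(volume.restrict Ω), 0 ≤ u x) ∧
  ∃ (Gu : EuclideanSpace ℝ (Fin N) → EuclideanSpace ℝ (Fin N))
    (v : EuclideanSpace ℝ (Fin N) → ℝ)
    (Gv : EuclideanSpace ℝ (Fin N) → EuclideanSpace ℝ (Fin N)),
    MemSobolevZero Ω (ENNReal.ofReal p) u Gu ∧
    MemSobolevZero Ω 1 v Gv ∧
    SolvesWeakPoisson Ω Gu v ∧
    SolvesWeakPoisson Ω Gv (fun x => ‖Gu x‖ ^ p + l * f x)

/-!
The datum is `f x = ‖x - a‖ ^ (-α)` with `a ∈ Ω` and `3 * p' < α < N / m`; the upper bound on `α`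
puts it in `L^m(Ω)`, and such an `α` exists exactly because `m < N / (3 * p')` (the alternative
`m < 1` in the hypothesis on `m` is excluded by `1 ≤ m`).

Nonexistence is a local test-function argument. Testing the equation for `v` with `ψ` and the
equation for `u` with `Δψ` eliminates `v` and gives
`∫ (|∇u|^p + l f) ψ = -∫ ∇Δψ · ∇u` (`integral_mul_eq_neg_integral_inner`).
If `|∇Δψ| ≤ A ψ^(1/p)`, Young's inequality absorbs the right-hand side into `∫ |∇u|^p ψ` up to a
constant on the support of `ψ`, so that `l ∫ f ψ ≤ A^p' / p' * |supp ψ|` whatever `u` is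
(`mul_integral_mul_le`). A large power of a bump function satisfies this pointwise condition, since
three derivatives cost three factors (`exists_norm_fderiv_coordLaplacian_pow_le`). Rescaled to
radius `s` around `a`, it has `A` of order `s^(-3)`, which yields
`l s^(N - α) ≤ K s^(N - 3 p')` (`exists_mul_rpow_le`); as `α > 3 p'`, this fails for small `s`.
The obstruction is local: only the equations in a neighbourhood of `a` are used.
-/

/-- The `i`-th partial derivative of `F`. -/
noncomputable def partialDeriv {N : ℕ} (i : Fin N) (F : EuclideanSpace ℝ (Fin N) → ℝ) :
    EuclideanSpace ℝ (Fin N) → ℝ :=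
  fun x => fderiv ℝ F x (EuclideanSpace.single i 1)

/-- The Laplacian of `F`, as the sum of the pure second partial derivatives. -/
noncomputable def coordLaplacian {N : ℕ} (F : EuclideanSpace ℝ (Fin N) → ℝ) :
    EuclideanSpace ℝ (Fin N) → ℝ :=
  fun x => ∑ i, partialDeriv i (partialDeriv i F) x

/-- The function `F` rescaled by the factor `s` around the point `a`. -/
noncomputable def rescale {N : ℕ} (a : EuclideanSpace ℝ (Fin N)) (s : ℝ) (F : EuclideanSpace ℝ (Fin N) → ℝ) :
    EuclideanSpace ℝ (Fin N) → ℝ :=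
  fun x => F (s⁻¹ • (x - a))

/-! ### Partial derivatives, rescaling and powers of a cutoff -/

section Calculus

variable {N : ℕ}

lemma gradient_apply (F : EuclideanSpace ℝ (Fin N) → ℝ) (x : EuclideanSpace ℝ (Fin N))
    (i : Fin N) : gradient F x i = partialDeriv i F x := by
  have h : inner ℝ (gradient F x) (EuclideanSpace.single i (1 : ℝ)) = partialDeriv i F x := by
    simp [gradient, partialDeriv]
  rw [← h, EuclideanSpace.inner_single_right]
  simp

lemma norm_gradient (F : EuclideanSpace ℝ (Fin N) → ℝ) (x : EuclideanSpace ℝ (Fin N)) :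
    ‖gradient F x‖ = ‖fderiv ℝ F x‖ := by
  simp [gradient]

lemma ContDiff.partialDeriv {F : EuclideanSpace ℝ (Fin N) → ℝ} (hF : ContDiff ℝ ∞ F)
    (i : Fin N) : ContDiff ℝ ∞ (partialDeriv i F) :=
  (hF.fderiv_right (m := ∞) (by simp)).clm_apply contDiff_const

lemma ContDiff.coordLaplacian {F : EuclideanSpace ℝ (Fin N) → ℝ} (hF : ContDiff ℝ ∞ F) :
    ContDiff ℝ ∞ (coordLaplacian F) :=
  ContDiff.sum fun i _ => (hF.partialDeriv i).partialDeriv i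

lemma tsupport_partialDeriv_subset (F : EuclideanSpace ℝ (Fin N) → ℝ) (i : Fin N) :
    tsupport (partialDeriv i F) ⊆ tsupport F :=
  tsupport_fderiv_apply_subset ℝ _

lemma tsupport_coordLaplacian_subset (F : EuclideanSpace ℝ (Fin N) → ℝ) :
    tsupport (coordLaplacian F) ⊆ tsupport F := by
  refine closure_minimal (fun x hx => ?_) (isClosed_tsupport F)
  by_contra hxF
  refine hx (Finset.sum_eq_zero fun i _ => image_eq_zero_of_notMem_tsupport fun h => hxF ?_)
  exact tsupport_partialDeriv_subset F i (tsupport_partialDeriv_subset _ i h)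

lemma IsTestFunction.of_tsupport_subset {Ω : Set (EuclideanSpace ℝ (Fin N))}
    {F G : EuclideanSpace ℝ (Fin N) → ℝ} (hF : IsTestFunction Ω F) (hG : ContDiff ℝ ∞ G)
    (h : tsupport G ⊆ tsupport F) : IsTestFunction Ω G :=
  ⟨hG, hF.compact_support.of_isClosed_subset (isClosed_tsupport G) h, h.trans hF.support_subset⟩

lemma IsTestFunction.partialDeriv {Ω : Set (EuclideanSpace ℝ (Fin N))}
    {F : EuclideanSpace ℝ (Fin N) → ℝ} (hF : IsTestFunction Ω F) (i : Fin N) :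
    IsTestFunction Ω (partialDeriv i F) :=
  hF.of_tsupport_subset (hF.smooth.partialDeriv i) (tsupport_partialDeriv_subset F i)

lemma IsTestFunction.coordLaplacian {Ω : Set (EuclideanSpace ℝ (Fin N))}
    {F : EuclideanSpace ℝ (Fin N) → ℝ} (hF : IsTestFunction Ω F) :
    IsTestFunction Ω (coordLaplacian F) :=
  hF.of_tsupport_subset hF.smooth.coordLaplacian (tsupport_coordLaplacian_subset F)

lemma IsTestFunction.exists_bound {Ω : Set (EuclideanSpace ℝ (Fin N))}
    {F : EuclideanSpace ℝ (Fin N) → ℝ} (hF : IsTestFunction Ω F) : ∃ C, ∀ x, ‖F x‖ ≤ C :=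
  hF.compact_support.exists_bound_of_continuous hF.smooth.continuous

lemma IsTestFunction.integrable_smul {E : Type*} [NormedAddCommGroup E] [NormedSpace ℝ E]
    {Ω : Set (EuclideanSpace ℝ (Fin N))} {F : EuclideanSpace ℝ (Fin N) → ℝ}
    (hF : IsTestFunction Ω F) {μ : Measure (EuclideanSpace ℝ (Fin N))}
    {g : EuclideanSpace ℝ (Fin N) → E} (hg : Integrable g μ) :
    Integrable (fun x => F x • g x) μ := by
  obtain ⟨C, hC⟩ := hF.exists_bound
  exact hg.bdd_smul C hF.smooth.continuous.aestronglyMeasurable (Eventually.of_forall hC)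

lemma fderiv_rescale (a : EuclideanSpace ℝ (Fin N)) (s : ℝ) (F : EuclideanSpace ℝ (Fin N) → ℝ)
    (x : EuclideanSpace ℝ (Fin N)) :
    fderiv ℝ (rescale a s F) x = s⁻¹ • fderiv ℝ F (s⁻¹ • (x - a)) := by
  have h := fderiv_comp_sub (𝕜 := ℝ) (f := fun y => F (s⁻¹ • y)) (x := x) a
  unfold rescale
  rw [h, fderiv_comp_smul]

lemma partialDeriv_rescale (a : EuclideanSpace ℝ (Fin N)) (s : ℝ)
    (F : EuclideanSpace ℝ (Fin N) → ℝ) (i : Fin N) :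
    partialDeriv i (rescale a s F) = s⁻¹ • rescale a s (partialDeriv i F) := by
  ext x
  simp [partialDeriv, fderiv_rescale, rescale]

lemma partialDeriv_const_smul (c : ℝ) (F : EuclideanSpace ℝ (Fin N) → ℝ) (i : Fin N) :
    partialDeriv i (c • F) = c • partialDeriv i F := by
  ext x
  simp [partialDeriv, fderiv_const_smul_field]

lemma coordLaplacian_rescale (a : EuclideanSpace ℝ (Fin N)) (s : ℝ)
    (F : EuclideanSpace ℝ (Fin N) → ℝ) :
    coordLaplacian (rescale a s F) = (s⁻¹ * s⁻¹) • rescale a s (coordLaplacian F) := by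
  ext x
  simp [coordLaplacian, partialDeriv_rescale, partialDeriv_const_smul, rescale, Finset.mul_sum,
    mul_assoc]

lemma fderiv_coordLaplacian_rescale (a : EuclideanSpace ℝ (Fin N)) (s : ℝ)
    (F : EuclideanSpace ℝ (Fin N) → ℝ) (x : EuclideanSpace ℝ (Fin N)) :
    fderiv ℝ (coordLaplacian (rescale a s F)) x =
      s⁻¹ ^ 3 • fderiv ℝ (coordLaplacian F) (s⁻¹ • (x - a)) := by
  rw [coordLaplacian_rescale, fderiv_const_smul_field, Pi.smul_apply, fderiv_rescale, smul_smul]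
  ring_nf

lemma fderiv_pow_mul {η g : EuclideanSpace ℝ (Fin N) → ℝ} (hη : ContDiff ℝ ∞ η)
    (hg : ContDiff ℝ ∞ g) (k : ℕ) (x : EuclideanSpace ℝ (Fin N)) :
    fderiv ℝ (fun y => η y ^ (k + 1) * g y) x =
      η x ^ k • (((k + 1 : ℝ) * g x) • fderiv ℝ η x + η x • fderiv ℝ g x) := by
  have h1 := ((hη.differentiable (by simp)) x).hasFDerivAt
  have h2 := ((hg.differentiable (by simp)) x).hasFDerivAt
  have h3 := (h1.pow (k + 1)).mul h2
  rw [show (fun y => η y ^ (k + 1) * g y) = ((fun y => η y ^ (k + 1)) * g) from rfl, h3.fderiv]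
  ext v
  simp
  ring

/-- A derivative of `η ^ (k + 1) * g` loses only one factor `η`. -/
lemma exists_partialDeriv_pow_mul {η g : EuclideanSpace ℝ (Fin N) → ℝ} (hη : ContDiff ℝ ∞ η)
    (hg : ContDiff ℝ ∞ g) (k : ℕ) (i : Fin N) :
    ∃ h : EuclideanSpace ℝ (Fin N) → ℝ, ContDiff ℝ ∞ h ∧
      partialDeriv i (fun y => η y ^ (k + 1) * g y) = fun y => η y ^ k * h y := by
  refine ⟨fun x => (k + 1 : ℝ) * g x * partialDeriv i η x + η x * partialDeriv i g x,
    ((contDiff_const.mul hg).mul (hη.partialDeriv i)).add (hη.mul (hg.partialDeriv i)), ?_⟩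
  ext x
  simp [partialDeriv, fderiv_pow_mul hη hg, mul_add]

lemma exists_coordLaplacian_pow {η : EuclideanSpace ℝ (Fin N) → ℝ} (hη : ContDiff ℝ ∞ η)
    (k : ℕ) : ∃ h : EuclideanSpace ℝ (Fin N) → ℝ, ContDiff ℝ ∞ h ∧
      coordLaplacian (fun y => η y ^ (k + 2)) = fun y => η y ^ k * h y := by
  have key (i : Fin N) : ∃ h : EuclideanSpace ℝ (Fin N) → ℝ, ContDiff ℝ ∞ h ∧
      partialDeriv i (partialDeriv i (fun y => η y ^ (k + 2))) = fun y => η y ^ k * h y := by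
    obtain ⟨g, hg, hg'⟩ := exists_partialDeriv_pow_mul hη
      (contDiff_const (c := (1 : ℝ))) (k + 1) i
    obtain ⟨h, hh, hh'⟩ := exists_partialDeriv_pow_mul hη hg k i
    refine ⟨h, hh, ?_⟩
    simp only [mul_one] at hg'
    rw [hg', hh']
  choose h hh hh' using key
  refine ⟨fun x => ∑ i, h i x, ContDiff.sum fun i _ => hh i, ?_⟩
  ext x
  simp [coordLaplacian, hh', Finset.mul_sum]

/-- Third derivatives of `η ^ (j + 3)` are controlled by `η ^ j`. -/
lemma exists_norm_fderiv_coordLaplacian_pow_le {η : EuclideanSpace ℝ (Fin N) → ℝ}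
    (hη : ContDiff ℝ ∞ η) (hηc : HasCompactSupport η) (j : ℕ) :
    ∃ C, 0 ≤ C ∧ ∀ x, ‖fderiv ℝ (coordLaplacian (fun y => η y ^ (j + 3))) x‖ ≤ C * |η x| ^ j := by
  obtain ⟨g, hg, hg'⟩ := exists_coordLaplacian_pow hη (j + 1)
  have hcont : Continuous (fun x =>
      ((j + 1 : ℝ) * g x) • fderiv ℝ η x + η x • fderiv ℝ g x) :=
    ((continuous_const.mul hg.continuous).smul (hη.continuous_fderiv (by simp))).add
      (hη.continuous.smul (hg.continuous_fderiv (by simp)))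
  have hsupp : HasCompactSupport (fun x =>
      ((j + 1 : ℝ) * g x) • fderiv ℝ η x + η x • fderiv ℝ g x) :=
    HasCompactSupport.intro hηc fun x hx => by
      rw [fderiv_of_notMem_tsupport ℝ hx, image_eq_zero_of_notMem_tsupport hx, smul_zero,
        zero_smul, add_zero]
  obtain ⟨C, hC⟩ := hsupp.exists_bound_of_continuous hcont
  refine ⟨C, (norm_nonneg _).trans (hC 0), fun x => ?_⟩
  rw [show j + 3 = j + 1 + 2 from rfl, hg', fderiv_pow_mul hη hg, norm_smul, norm_pow,
    Real.norm_eq_abs, mul_comm]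
  exact mul_le_mul_of_nonneg_right (hC x) (by positivity)

end Calculus

/-! ### Elimination of `v` and the a priori estimate -/

section Testing

variable {N : ℕ} {Ω : Set (EuclideanSpace ℝ (Fin N))}

/-- Green's formula, with the Laplacian moved onto the test function. -/
lemma integral_inner_gradient_eq_neg {v : EuclideanSpace ℝ (Fin N) → ℝ}
    {G : EuclideanSpace ℝ (Fin N) → EuclideanSpace ℝ (Fin N)} (hv : MemSobolevZero Ω 1 v G)
    {ψ : EuclideanSpace ℝ (Fin N) → ℝ} (hψ : IsTestFunction Ω ψ) :
    ∫ x in Ω, inner ℝ (gradient ψ x) (G x) = -∫ x in Ω, v x * coordLaplacian ψ x := by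
  have hvi : Integrable v (volume.restrict Ω) := memLp_one_iff_integrable.1 hv.memLp
  have hGi : Integrable G (volume.restrict Ω) := memLp_one_iff_integrable.1 hv.memLp_grad
  have hGi' (i : Fin N) : Integrable (fun x => G x i) (volume.restrict Ω) :=
    (EuclideanSpace.proj (𝕜 := ℝ) i).integrable_comp hGi
  have hcoord (i : Fin N) : ∫ x in Ω, partialDeriv i ψ x * G x i =
      -∫ x in Ω, v x * partialDeriv i (partialDeriv i ψ) x := by
    have hφ := hψ.partialDeriv i
    have h := congrArg (EuclideanSpace.proj (𝕜 := ℝ) i) (hv.weakGradient.integral_eq _ hφ)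
    have hI1 : Integrable (fun x => v x • gradient (partialDeriv i ψ) x) (volume.restrict Ω) := by
      have hc : Continuous (fun x => gradient (partialDeriv i ψ) x) :=
        (InnerProductSpace.toDual ℝ _).symm.continuous.comp
          (hφ.smooth.continuous_fderiv (by simp))
      obtain ⟨C, hC⟩ := (hφ.compact_support.fderiv ℝ).exists_bound_of_continuous
        (hφ.smooth.continuous_fderiv (by simp))
      exact hvi.smul_bdd C hc.aestronglyMeasurable
        (Eventually.of_forall fun x => (norm_gradient _ x).trans_le (hC x))
    rw [map_neg, ← ContinuousLinearMap.integral_comp_comm _ hI1,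
      ← ContinuousLinearMap.integral_comp_comm _ (hφ.integrable_smul hGi)] at h
    simp only [map_smul, EuclideanSpace.coe_proj, gradient_apply, smul_eq_mul] at h
    linarith
  have hI2 (i : Fin N) : Integrable (fun x => v x * partialDeriv i (partialDeriv i ψ) x)
      (volume.restrict Ω) := by
    simpa [mul_comm] using ((hψ.partialDeriv i).partialDeriv i).integrable_smul hvi
  calc ∫ x in Ω, inner ℝ (gradient ψ x) (G x)
      = ∫ x in Ω, ∑ i, partialDeriv i ψ x * G x i := by
        congr with x
        rw [PiLp.inner_apply]
        simp only [gradient_apply, RCLike.inner_apply, conj_trivial, mul_comm]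
    _ = ∑ i, ∫ x in Ω, partialDeriv i ψ x * G x i :=
        integral_finsetSum _ fun i _ => (hψ.partialDeriv i).integrable_smul (hGi' i)
    _ = -∑ i, ∫ x in Ω, v x * partialDeriv i (partialDeriv i ψ) x := by
        simp [hcoord]
    _ = -∫ x in Ω, v x * coordLaplacian ψ x := by
        rw [← integral_finsetSum _ fun i _ => hI2 i]
        simp [coordLaplacian, Finset.mul_sum]

/-- Testing both equations of the system eliminates `v`: the first with `Δψ`, the second
with `ψ`. -/
lemma integral_mul_eq_neg_integral_inner {v h : EuclideanSpace ℝ (Fin N) → ℝ}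
    {Gu Gv : EuclideanSpace ℝ (Fin N) → EuclideanSpace ℝ (Fin N)}
    (hv : MemSobolevZero Ω 1 v Gv) (h1 : SolvesWeakPoisson Ω Gu v)
    (h2 : SolvesWeakPoisson Ω Gv h) {ψ : EuclideanSpace ℝ (Fin N) → ℝ}
    (hψ : IsTestFunction Ω ψ) :
    ∫ x in Ω, h x * ψ x = -∫ x in Ω, inner ℝ (gradient (coordLaplacian ψ) x) (Gu x) := by
  rw [← h2 ψ hψ, integral_inner_gradient_eq_neg hv hψ, h1 _ hψ.coordLaplacian]

/-- The a priori estimate: the gradient term absorbs `∇Δψ · ∇u` by Young's inequality, which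
leaves a bound for the datum that does not involve the solution. -/
lemma mul_integral_mul_le [IsFiniteMeasure (volume.restrict Ω)] {p q l A : ℝ} {f u ψ : EuclideanSpace ℝ (Fin N) → ℝ}
    (hpq : p.HolderConjugate q) (hf : Integrable f (volume.restrict Ω))
    (hu : IsPositiveWeakSolution Ω p l f u) (hψ : IsTestFunction Ω ψ) (hψ0 : ∀ x, 0 ≤ ψ x)
    (hA : 0 ≤ A) {B : Set (EuclideanSpace ℝ (Fin N))} (hB : MeasurableSet B)
    (hBΩ : B ⊆ Ω) (hBfin : volume B ≠ ⊤) (hψB : tsupport ψ ⊆ B)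
    (hbound : ∀ x, ‖fderiv ℝ (coordLaplacian ψ) x‖ ≤ A * ψ x ^ p⁻¹) :
    l * ∫ x in Ω, f x * ψ x ≤ A ^ q / q * volume.real B := by
  obtain ⟨-, Gu, v, Gv, hGu, hGv, h1, h2⟩ := hu
  have hp := hpq.pos
  have hG : Integrable (fun x => ‖Gu x‖ ^ p) (volume.restrict Ω) := by
    have := hGu.memLp_grad.integrable_norm_rpow (by simpa using hp) (by simp)
    rwa [ENNReal.toReal_ofReal hp.le] at this
  have hI1 : Integrable (fun x => ‖Gu x‖ ^ p * ψ x) (volume.restrict Ω) := by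
    simpa [mul_comm] using hψ.integrable_smul hG
  have hI2 : Integrable (fun x => l * (f x * ψ x)) (volume.restrict Ω) := by
    simpa [mul_comm] using (hψ.integrable_smul hf).const_mul l
  have hI3 : Integrable (B.indicator fun _ => A ^ q / q) (volume.restrict Ω) :=
    ((integrable_indicator_iff hB).2 (integrableOn_const hBfin)).restrict
  have hq : 0 ≤ A ^ q / q := div_nonneg (Real.rpow_nonneg hA q) hpq.symm.nonneg
  have hpt (x : EuclideanSpace ℝ (Fin N)) :
      -inner ℝ (gradient (coordLaplacian ψ) x) (Gu x) ≤
        ‖Gu x‖ ^ p * ψ x + B.indicator (fun _ => A ^ q / q) x := by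
    by_cases hx : x ∈ B
    · have hy := Real.young_inequality_of_nonneg (a := ψ x ^ p⁻¹ * ‖Gu x‖) (b := A)
        (mul_nonneg (Real.rpow_nonneg (hψ0 x) _) (norm_nonneg _)) hA hpq
      rw [Real.mul_rpow (Real.rpow_nonneg (hψ0 x) _) (norm_nonneg _),
        Real.rpow_inv_rpow (hψ0 x) hp.ne'] at hy
      have hle : ψ x * ‖Gu x‖ ^ p / p ≤ ψ x * ‖Gu x‖ ^ p :=
        div_le_self (mul_nonneg (hψ0 x) (Real.rpow_nonneg (norm_nonneg _) _)) hpq.lt.le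
      have hcs : -inner ℝ (gradient (coordLaplacian ψ) x) (Gu x) ≤
          A * ψ x ^ p⁻¹ * ‖Gu x‖ := by
        refine (neg_le_abs _).trans ((abs_real_inner_le_norm _ _).trans ?_)
        rw [norm_gradient]
        exact mul_le_mul_of_nonneg_right (hbound x) (norm_nonneg _)
      rw [Set.indicator_of_mem hx]
      linarith
    · have hz : fderiv ℝ (coordLaplacian ψ) x = 0 :=
        fderiv_of_notMem_tsupport ℝ fun h => hx (hψB (tsupport_coordLaplacian_subset ψ h))
      have hz' : gradient (coordLaplacian ψ) x = 0 := by simp [gradient, hz]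
      rw [hz', Set.indicator_of_notMem hx]
      simpa using mul_nonneg (Real.rpow_nonneg (norm_nonneg (Gu x)) p) (hψ0 x)
  have hI4 : Integrable (fun x => inner ℝ (gradient (coordLaplacian ψ) x) (Gu x))
      (volume.restrict Ω) := by
    have hfd := hψ.smooth.coordLaplacian.continuous_fderiv (by simp)
    have hGm := hGu.memLp_grad.aestronglyMeasurable
    have hgm : AEStronglyMeasurable (fun x => gradient (coordLaplacian ψ) x)
        (volume.restrict Ω) :=
      ((InnerProductSpace.toDual ℝ _).symm.continuous.comp hfd).aestronglyMeasurable
    have hGi : Integrable Gu (volume.restrict Ω) :=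
      hGu.memLp_grad.integrable (by simpa using hpq.lt.le)
    obtain ⟨C, hC⟩ :=
      (hψ.coordLaplacian.compact_support.fderiv ℝ).exists_bound_of_continuous hfd
    refine (hGi.norm.const_mul C).mono' (hgm.inner hGm) (Eventually.of_forall fun x => ?_)
    refine (norm_inner_le_norm _ _).trans ?_
    rw [norm_gradient]
    exact mul_le_mul_of_nonneg_right (hC x) (norm_nonneg _)
  have hid := integral_mul_eq_neg_integral_inner hGv h1 h2 hψ
  have hle : ∫ x in Ω, (‖Gu x‖ ^ p + l * f x) * ψ x ≤
      ∫ x in Ω, (‖Gu x‖ ^ p * ψ x + B.indicator (fun _ => A ^ q / q) x) := by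
    rw [hid, ← integral_neg]
    exact integral_mono hI4.neg (hI1.add hI3) hpt
  simp only [add_mul, mul_assoc] at hle
  rw [integral_add hI1 hI2, integral_add hI1 hI3, integral_const_mul, setIntegral_indicator hB,
    Set.inter_eq_self_of_subset_right hBΩ, setIntegral_const, smul_eq_mul] at hle
  linarith

end Testing

/-! ### The singular datum -/

section Singularity

variable {N : ℕ}

lemma memLp_norm_sub_rpow_neg (hN : 1 ≤ N) {Ω : Set (EuclideanSpace ℝ (Fin N))}
    (hΩ : Bornology.IsBounded Ω) (a : EuclideanSpace ℝ (Fin N)) {m α : ℝ} (hm : 0 < m)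
    (hα : α * m < N) :
    MemLp (fun x => ‖x - a‖ ^ (-α)) (ENNReal.ofReal m) (volume.restrict Ω) := by
  have hmeas : Measurable (fun x : EuclideanSpace ℝ (Fin N) => ‖x - a‖ ^ (-α)) := by fun_prop
  rw [← integrable_norm_rpow_iff hmeas.aestronglyMeasurable (by simpa using hm) (by simp),
    ENNReal.toReal_ofReal hm.le]
  have hloc : LocallyIntegrable
      (fun x : EuclideanSpace ℝ (Fin N) => ‖‖x‖ ^ (-α)‖ ^ m) volume := by
    refine locallyIntegrable_of_norm_le_rpow (C := 1) (α := α * m) (by simpa using hN)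
      (by simpa using hα) (Eventually.of_forall fun x => ?_)
      (by fun_prop : Measurable _).aestronglyMeasurable
    rw [Real.norm_of_nonneg (by positivity), Real.norm_of_nonneg (by positivity),
      ← Real.rpow_mul (norm_nonneg x), one_mul, neg_mul]
  obtain ⟨R, hR⟩ := hΩ.subset_closedBall a
  have hK := hloc.integrableOn_isCompact (isCompact_closedBall (0 : EuclideanSpace ℝ (Fin N)) R)
  rw [← (measurePreserving_sub_right volume a).integrableOn_comp_preimage
    (measurableEmbedding_subRight a)] at hK
  refine hK.mono_set fun x hx => ?_
  simpa [dist_eq_norm] using hR hx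

/-- A solution with datum `‖x - a‖ ^ (-α)` forces `l * s ^ (3 * q - α) ≤ K` at every small scale
`s`, with `K` independent of `l`, of the solution and of `s`: the a priori estimate is applied to
the cutoff `η ^ (j + 3)` rescaled by `s`, whose third derivatives are of order `s⁻¹ ^ 3`, and the
volume factors `s ^ N` on the two sides cancel. -/
lemma exists_mul_rpow_le (hN : 1 ≤ N) {Ω : Set (EuclideanSpace ℝ (Fin N))}
    [IsFiniteMeasure (volume.restrict Ω)] (a : EuclideanSpace ℝ (Fin N)) {p q α : ℝ} (hpq : p.HolderConjugate q) (hα : 0 ≤ α)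
    (hf : Integrable (fun x => ‖x - a‖ ^ (-α)) (volume.restrict Ω)) :
    ∃ K : ℝ, ∀ l u s, 0 ≤ l → 0 < s → Metric.closedBall a (s * 2) ⊆ Ω →
      IsPositiveWeakSolution Ω p l (fun x => ‖x - a‖ ^ (-α)) u → l * s ^ (3 * q - α) ≤ K := by
  have : NeZero N := ⟨by omega⟩
  let η : ContDiffBump (0 : EuclideanSpace ℝ (Fin N)) := ⟨1, 2, one_pos, one_lt_two⟩
  have hp1 : 0 < p - 1 := sub_pos.2 hpq.lt
  -- `j` is so large that `η ^ j ≤ (η ^ (j + 3)) ^ (1 / p)`.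
  obtain ⟨j, hj⟩ := exists_nat_ge (3 / (p - 1))
  have hj' : ((j + 3 : ℕ) : ℝ) * p⁻¹ ≤ j := by
    rw [← div_eq_mul_inv, div_le_iff₀ hpq.pos]
    rw [div_le_iff₀ hp1] at hj
    push_cast
    linarith
  obtain ⟨C, hC0, hC⟩ := exists_norm_fderiv_coordLaplacian_pow_le (η := η) η.contDiff
    η.hasCompactSupport j
  refine ⟨C ^ q / q * 2 ^ N, fun l u s hl hs hΩs hu => ?_⟩
  let F : EuclideanSpace ℝ (Fin N) → ℝ := fun y => η y ^ (j + 3)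
  have hFsupp : tsupport (rescale a s F) ⊆ Metric.closedBall a (s * 2) := by
    refine closure_minimal (fun x hx => ?_) Metric.isClosed_closedBall
    have hη0 : η (s⁻¹ • (x - a)) ≠ 0 := fun h => hx (by simp [rescale, F, h])
    have hmem : s⁻¹ • (x - a) ∈ Function.support η := hη0
    rw [η.support_eq, mem_ball_zero_iff, norm_smul, Real.norm_of_nonneg (by positivity)] at hmem
    rw [mem_closedBall_iff_norm]
    have : s⁻¹ * ‖x - a‖ < 2 := hmem
    rw [inv_mul_lt_iff₀ hs] at this
    exact this.le
  have hFsmooth : ContDiff ℝ ∞ (rescale a s F) :=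
    (η.contDiff.pow (j + 3)).comp (contDiff_id.sub contDiff_const |>.const_smul s⁻¹)
  have htest : IsTestFunction Ω (rescale a s F) :=
    ⟨hFsmooth, (isCompact_closedBall a _).of_isClosed_subset (isClosed_tsupport _) hFsupp,
      hFsupp.trans hΩs⟩
  have hbound (x : EuclideanSpace ℝ (Fin N)) :
      ‖fderiv ℝ (coordLaplacian (rescale a s F)) x‖ ≤
        (C * s⁻¹ ^ 3) * rescale a s F x ^ p⁻¹ := by
    rw [fderiv_coordLaplacian_rescale, norm_smul, Real.norm_of_nonneg (by positivity)]
    set y := s⁻¹ • (x - a) with hy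
    have hpow : |η y| ^ j ≤ rescale a s F x ^ p⁻¹ := by
      simp only [rescale, F, ← hy]
      rw [abs_of_nonneg η.nonneg, ← Real.rpow_natCast, ← Real.rpow_natCast,
        ← Real.rpow_mul η.nonneg]
      exact Real.rpow_le_rpow_of_exponent_ge' η.nonneg η.le_one
        (mul_nonneg (Nat.cast_nonneg _) (inv_nonneg.2 hpq.nonneg)) hj'
    calc s⁻¹ ^ 3 * ‖fderiv ℝ (coordLaplacian F) y‖ ≤ s⁻¹ ^ 3 * (C * |η y| ^ j) := by
          gcongr
          exact hC y
      _ ≤ s⁻¹ ^ 3 * (C * rescale a s F x ^ p⁻¹) := by gcongr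
      _ = _ := by ring
  have hF0 (x : EuclideanSpace ℝ (Fin N)) : 0 ≤ rescale a s F x := pow_nonneg η.nonneg _
  have hupper := mul_integral_mul_le hpq hf hu htest hF0
    (A := C * s⁻¹ ^ 3) (by positivity) measurableSet_closedBall hΩs
    (isCompact_closedBall a _).measure_lt_top.ne hFsupp hbound
  have hballΩ : Metric.ball a s ⊆ Ω :=
    (Metric.ball_subset_closedBall.trans (Metric.closedBall_subset_closedBall (by linarith))).trans
      hΩs
  -- The centre is excluded, since `0 ^ (-α) = 0` in Lean.
  have hlower : s ^ (-α) * volume.real (Metric.ball a s) ≤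
      ∫ x in Ω, ‖x - a‖ ^ (-α) * rescale a s F x := by
    have hmeas : MeasurableSet (Metric.ball a s \ {a}) :=
      Metric.isOpen_ball.measurableSet.diff (measurableSet_singleton a)
    have hfin : volume (Metric.ball a s \ {a}) ≠ ⊤ :=
      ((measure_mono Set.sdiff_subset).trans_lt measure_ball_lt_top).ne
    have hreal : volume.real (Metric.ball a s \ {a}) = volume.real (Metric.ball a s) := by
      rw [measureReal_def, measureReal_def, measure_sdiff_null (measure_singleton a)]
    rw [← hreal, mul_comm, ← smul_eq_mul, ← setIntegral_const,
      ← Set.inter_eq_self_of_subset_right (Set.sdiff_subset.trans hballΩ),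
      ← setIntegral_indicator hmeas]
    refine integral_mono ((integrable_indicator_iff hmeas).2 (integrableOn_const hfin)).restrict
      ?_ fun x => ?_
    · simpa [mul_comm] using htest.integrable_smul hf
    · by_cases hx : x ∈ Metric.ball a s \ {a}
      · have hxs : ‖x - a‖ < s := mem_ball_iff_norm.1 hx.1
        have hx0 : 0 < ‖x - a‖ := norm_pos_iff.2 (sub_ne_zero.2 hx.2)
        have hη1 : η (s⁻¹ • (x - a)) = 1 := by
          refine η.one_of_mem_closedBall ?_
          rw [mem_closedBall_zero_iff, norm_smul, Real.norm_of_nonneg (by positivity),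
            inv_mul_le_iff₀ hs]
          simpa [η] using hxs.le
        simp only [Set.indicator_of_mem hx, rescale, F, hη1, one_pow, mul_one]
        exact Real.rpow_le_rpow_of_nonpos hx0 hxs.le (neg_nonpos.2 hα)
      · rw [Set.indicator_of_notMem hx]
        exact mul_nonneg (by positivity) (hF0 x)
  have hV : 0 < volume.real (Metric.ball a s) :=
    ENNReal.toReal_pos (Metric.measure_ball_pos volume a hs).ne' measure_ball_lt_top.ne
  have hVV : volume.real (Metric.closedBall a (s * 2)) =
      2 ^ N * volume.real (Metric.ball a s) := by
    rw [measureReal_def, measureReal_def, Measure.addHaar_closedBall _ _ (by positivity),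
      Measure.addHaar_ball_of_pos _ _ hs, ENNReal.toReal_mul, ENNReal.toReal_mul,
      ENNReal.toReal_ofReal (by positivity), ENNReal.toReal_ofReal (by positivity)]
    simp only [finrank_euclideanSpace, Fintype.card_fin]
    ring
  have hA : (C * s⁻¹ ^ 3) ^ q = C ^ q * s ^ (-(3 * q)) := by
    rw [Real.mul_rpow hC0 (by positivity), ← Real.rpow_natCast, ← Real.rpow_mul (by positivity),
      Real.inv_rpow hs.le, Real.rpow_neg hs.le]
    norm_num
  have h := (mul_le_mul_of_nonneg_left hlower hl).trans hupper
  rw [hVV, hA] at h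
  have h' : l * s ^ (-α) ≤ C ^ q / q * 2 ^ N * s ^ (-(3 * q)) := by
    refine le_of_mul_le_mul_right (le_of_eq_of_le ?_ (h.trans_eq ?_)) hV <;> ring
  have hs3 : 0 < s ^ (3 * q) := Real.rpow_pos_of_pos hs _
  calc l * s ^ (3 * q - α) = l * s ^ (-α) * s ^ (3 * q) := by
        rw [mul_assoc, ← Real.rpow_add hs]
        ring_nf
    _ ≤ C ^ q / q * 2 ^ N * s ^ (-(3 * q)) * s ^ (3 * q) := by gcongr
    _ = C ^ q / q * 2 ^ N := by
        rw [mul_assoc, ← Real.rpow_add hs]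
        simp

end Singularity

theorem theorem2p4 (N : ℕ) (Ω : Set (EuclideanSpace ℝ (Fin N)))
    (hΩ_open : IsOpen Ω) (hΩ_bdd : Bornology.IsBounded Ω) (hΩ_ne : Ω.Nonempty)
    (p m : ℝ) (hp : 1 < p) (hm : 1 ≤ m)
    (hm_lt : m < max 1 ((N : ℝ) / (3 * Real.conjExponent p))) :
    ∃ f : EuclideanSpace ℝ (Fin N) → ℝ,
      MemLp f (ENNReal.ofReal m) (volume.restrict Ω) ∧
      (∀ᵐ x ∂(volume.restrict Ω), 0 ≤ f x) ∧
      ¬ (f =ᵐ[volume.restrict Ω] 0) ∧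
      ∀ l : ℝ, 0 < l →
        ¬ ∃ u : EuclideanSpace ℝ (Fin N) → ℝ, IsPositiveWeakSolution Ω p l f u := by
  have hpq := Real.HolderConjugate.conjExponent hp
  set q := Real.conjExponent p
  have hq : 0 < q := hpq.symm.pos
  have hm0 : 0 < m := one_pos.trans_le hm
  have hmN : m * (3 * q) < N := by
    rcases lt_max_iff.1 hm_lt with h | h
    · exact absurd hm h.not_ge
    · rwa [lt_div_iff₀ (by positivity)] at h
  have hN : 1 ≤ N := by
    have : (0 : ℝ) < N := lt_trans (by positivity) hmN
    exact_mod_cast this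
  have : NeZero N := ⟨by omega⟩
  obtain ⟨α, hα1, hα2⟩ := exists_between
    (show 3 * q < N / m by rwa [lt_div_iff₀ hm0, mul_comm])
  rw [lt_div_iff₀ hm0] at hα2
  obtain ⟨a, ha⟩ := hΩ_ne
  have hmem := memLp_norm_sub_rpow_neg hN hΩ_bdd a hm0 hα2
  refine ⟨fun x => ‖x - a‖ ^ (-α), hmem, Eventually.of_forall fun x => by positivity,
    fun h0 => ?_, ?_⟩
  · have hfalse : ∀ᵐ x ∂(volume.restrict Ω), x = a := by
      filter_upwards [h0] with x hx
      by_contra hxa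
      exact (Real.rpow_pos_of_pos (norm_pos_iff.2 (sub_ne_zero.2 hxa)) (-α)).ne' hx
    rw [ae_restrict_iff' hΩ_open.measurableSet] at hfalse
    have hnull : volume (Ω \ {a}) = 0 := by
      refine measure_mono_null (fun x hx => ?_) hfalse
      exact fun h => hx.2 (h hx.1)
    rw [measure_sdiff_null (measure_singleton a)] at hnull
    exact (hΩ_open.measure_pos volume ⟨a, ha⟩).ne' hnull
  · rintro l hl ⟨u, hu⟩
    have : IsFiniteMeasure (volume.restrict Ω) :=
      ⟨by simpa using hΩ_bdd.measure_lt_top⟩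
    obtain ⟨K, hK⟩ := exists_mul_rpow_le hN a hpq (by linarith)
      (hmem.integrable (by simpa using hm))
    have hlarge : ∀ᶠ s in 𝓝[>] (0 : ℝ), K / l < s ^ (3 * q - α) :=
      (tendsto_rpow_neg_nhdsGT_zero (by linarith)).eventually_gt_atTop _
    obtain ⟨ε, hε, hεΩ⟩ := Metric.nhds_basis_closedBall.mem_iff.1 (hΩ_open.mem_nhds ha)
    obtain ⟨s, hs, hs0, hsε⟩ := (hlarge.and (Ioo_mem_nhdsGT (half_pos hε))).exists
    have hle := hK l u s hl.le hs0
      ((Metric.closedBall_subset_closedBall (by linarith)).trans hεΩ) hu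
    rw [div_lt_iff₀ hl] at hs
    linarith
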